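/- Let $n\ge 1$. For a measurable, extended real-valued function $f$ on $\mathbb R^n$ (we write $f\in\mathfrak M(\mathbb R^n)$), or for one with values in $[0,\infty]$, let $f^*(t)=\inf\{\lambda\ge 0: |\{x\in\mathbb R^n: |f(x)|>\lambda\}|\le t\}$ (with $\inf\emptyset=\infty$) be its non-increasing rearrangement. A weight on $(0,\infty)$ is a non-negative locally integrable function on $(0,\infty)$. All integrals, suprema and norms below take values in $[0,\infty]$, with $0\cdot\infty=0$. For $\alpha>0$, $\phi:(0,\infty)\to(0,\infty)$ and a weight $b$ put $\|f\|_{\Lambda^\alpha(b)}=\big(\int_0^\infty [f^*(s)]^\alpha b(s)\,ds\big)^{1/\alpha}$, $$M_{\phi,\Lambda^\alpha(b)}f(x)=\sup_{Q\ni x}\frac{\|f\chi_Q\|_{\Lambda^\alpha(b)}}{\phi(|Q|)},\qquad x\in\mathbb R^n,$$ where the supremum is over all open cubes $Q\subset\mathbb R^n$ containing $x$, with sides parallel to the coordinate axes. Let $B(t)=\int_0^t b(s)\,ds$ and, for functions $u,g:(0,\infty)\to[0,\infty]$ with $g$ measurable, $$(T_{u,b}g)(t)=\sup_{t\le\tau<\infty}\frac{u(\tau)}{B(\tau)}\int_0^\tau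 g(y)b(y)\,dy ,\qquad t>0.$$ A function $\psi:(0,\infty)\to(0,\infty)$ is quasi-increasing if for some $K>0$ one has $\psi(t_1)\le K\psi(t_2)$ whenever $0<t_1\le t_2$; it satisfies $\psi\in\Delta_2$ if for some $K>0$ one has $\psi(2t)\le K\psi(t)$ for all $t>0$; and $\psi\in Q_r$ if for some $K>0$ one has $\psi\big(\sum_{i=1}^k t_i\big)\le K\big(\sum_{i=1}^k\psi(t_i)^r\big)^{1/r}$ for all $k\ge1$ and all $t_1,\dots,t_k>0$. **Theorem 1.1.** Let $0<p_1,p_2,m_1,m_2<\infty$, $0<\alpha\le r<\infty$, and let $v,w$ be weights on $(0,\infty)$. Let $\phi:(0,\infty)\to(0,\infty)$ be quasi-increasing with $\phi\in Q_r$. Let $b$ be a weight on $(0,\infty)$ such that $0<B(t)<\infty$ for all $t>0$, $B\in\Delta_2$, $B(\infty)=\int_0^\infty b(s)\,ds=\infty$, and $B(t)/t^{\alpha/r}$ is quasi-increasing. Then there is a constant $0<C<\infty$ such that $$\bigg(\int_0^\infty\Big(\int_0^x\big[(M_{\phi,\Lambda^\alpha(b)}f)^*(t)\big]^{p_2}dt\Big)^{\frac{m_2}{p_2}}w(x)\,dx\bigg)^{\frac1{m_2}}\le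 C\bigg(\int_0^\infty\Big(\int_0^x[f^*(\tau)]^{p_1}d\tau\Big)^{\frac{m_1}{p_1}}v(x)\,dx\bigg)^{\frac1{m_1}}$$ for all $f\in\mathfrak M(\mathbb R^n)$ (that is, $M_{\phi,\Lambda^\alpha(b)}$ is bounded from $\operatorname{G\Gamma}(p_1,m_1,v)$ into $\operatorname{G\Gamma}(p_2,m_2,w)$) if and only if there is a constant $0<C<\infty$ such that $$\bigg(\int_0^\infty\Big(\int_0^x\big[T_{B/\phi^\alpha,b}h^*(t)\big]^{\frac{p_2}{\alpha}}dt\Big)^{\frac{m_2}{p_2}}w(x)\,dx\bigg)^{\frac1{m_2}}\le C\bigg(\int_0^\infty\Big(\int_0^x[h^*(\tau)]^{\frac{p_1}{\alpha}}d\tau\Big)^{\frac{m_1}{p_1}}v(x)\,dx\bigg)^{\frac1{m_1}}$$ for all $h\in\mathfrak M(\mathbb R^n)$. -/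

import Mathlib

open MeasureTheory Set
open scoped ENNReal NNReal

/-- A weight on `(0,∞)`: a non-negative, locally integrable function. -/
def IsWeight (w : ℝ → ℝ) : Prop :=
  (∀ t, 0 < t → 0 ≤ w t) ∧ LocallyIntegrableOn w (Ioi 0) volume

/-- The `Δ₂`-condition for a function on `(0,∞)`. -/
def DeltaTwo (ψ : ℝ → ℝ) : Prop :=
  ∃ C : ℝ, 0 < C ∧ ∀ t, 0 < t → ψ (2 * t) ≤ C * ψ t

/-- Quasi-increasing functions on `(0,∞)`. -/
def QuasiIncreasing (ψ : ℝ → ℝ) : Prop :=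
  ∃ C : ℝ, 0 < C ∧ ∀ s t, 0 < s → s ≤ t → ψ s ≤ C * ψ t

/-- The `Q_r`-condition on `(0,∞)`: the constant does not depend on the number `k` of points. -/
def QCondition (r : ℝ) (ψ : ℝ → ℝ) : Prop :=
  ∃ C : ℝ, 0 < C ∧ ∀ (k : ℕ) (t : Fin k → ℝ), 0 < k → (∀ i, 0 < t i) →
    ψ (∑ i, t i) ≤ C * (∑ i, ψ (t i) ^ r) ^ (1 / r)

/-- `B(t) = ∫₀ᵗ b(s) ds`, as an element of `[0,∞]`. -/
noncomputable def weightPrimitive (b : ℝ → ℝ) (t : ℝ) : ℝ≥0∞ :=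
  ∫⁻ s in Ioo 0 t, ENNReal.ofReal (b s)

/-- The non-increasing rearrangement, with respect to Lebesgue measure on `ℝⁿ`, of a function `g`
with values in `[0,∞]`:
`g^*(t) = inf {c ≥ 0 : |{x : g(x) > c}| ≤ t}` (equal to `∞` if no finite `c` qualifies). -/
noncomputable def rearr {n : ℕ} (g : (Fin n → ℝ) → ℝ≥0∞) (t : ℝ) : ℝ≥0∞ :=
  sInf {c : ℝ≥0∞ | volume {x | c < g x} ≤ ENNReal.ofReal t}

/-- The modulus `|f|` of an extended real-valued function. -/
noncomputable def modulus {n : ℕ} (f : (Fin n → ℝ) → EReal) (x : Fin n → ℝ) : ℝ≥0∞ :=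
  (f x).abs

/-- The functional of the classical Lorentz space `Λ^α(b)` on `ℝⁿ`:
`(∫₀^∞ [g^*(s)]^α b(s) ds)^{1/α}`. -/
noncomputable def lambdaNorm {n : ℕ} (α : ℝ) (b : ℝ → ℝ) (g : (Fin n → ℝ) → ℝ≥0∞) : ℝ≥0∞ :=
  (∫⁻ s in Ioi (0 : ℝ), rearr g s ^ α * ENNReal.ofReal (b s)) ^ (1 / α)

/-- The functional of the generalized Lorentz space `GΓ(p,m,v)` on `ℝⁿ`:
`(∫₀^∞ (∫₀ˣ [g^*(τ)]^p dτ)^{m/p} v(x) dx)^{1/m}`. -/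
noncomputable def gGammaNorm {n : ℕ} (p m : ℝ) (v : ℝ → ℝ) (g : (Fin n → ℝ) → ℝ≥0∞) : ℝ≥0∞ :=
  (∫⁻ x in Ioi (0 : ℝ),
    (∫⁻ τ in Ioo 0 x, rearr g τ ^ p) ^ (m / p) * ENNReal.ofReal (v x)) ^ (1 / m)

/-- The open cube in `ℝⁿ` with sides parallel to the axes, lower corner `a` and side length `l`. -/
def openCube {n : ℕ} (a : Fin n → ℝ) (l : ℝ) : Set (Fin n → ℝ) :=
  {x | ∀ i, a i < x i ∧ x i < a i + l}

/-- The generalized maximal function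
`(M_{φ,Λ^α(b)} f)(x) = sup_{Q ∋ x} ‖f χ_Q‖_{Λ^α(b)} / φ(|Q|)`, the supremum running over all open
cubes `Q` containing `x`, with sides parallel to the axes. -/
noncomputable def genMaximal {n : ℕ} (φ : ℝ → ℝ) (α : ℝ) (b : ℝ → ℝ)
    (f : (Fin n → ℝ) → EReal) (x : Fin n → ℝ) : ℝ≥0∞ :=
  ⨆ (a : Fin n → ℝ) (l : ℝ) (_ : 0 < l) (_ : x ∈ openCube a l),
    lambdaNorm α b (modulus ((openCube a l).indicator f)) /
      ENNReal.ofReal (φ (volume (openCube a l)).toReal)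

/-- The iterated Hardy-type operator involving suprema
`(T_{u,b} g)(t) = sup_{t ≤ τ < ∞} (u(τ) / B(τ)) ∫₀^τ g(y) b(y) dy`. -/
noncomputable def supHardy (u : ℝ → ℝ≥0∞) (b : ℝ → ℝ) (g : ℝ → ℝ≥0∞) (t : ℝ) : ℝ≥0∞ :=
  ⨆ (τ : ℝ) (_ : t ≤ τ),
    u τ / weightPrimitive b τ * ∫⁻ y in Ioo 0 τ, g y * ENNReal.ofReal (b y)

/-! Everything rests on two estimates of rearrangements, with u = B/φ^α. Upper bound, for every f:
(M f)^*(t) ≤ C [T_{u,b}((f^*)^α)(t)]^{1/α} (`exists_rearr_genMaximal_le`). A compact part of {M f >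
c} of measure above t is covered by finitely many cubes with c φ(|Q|) < ‖fχ_Q‖. Vitali selects
disjoint ones of total volume τ ≥ t/5^n. The condition Q_r bounds φ(τ) by the ℓ^r sum of the φ(|Q|),
and the lower r-estimate of Λ^α(b) on disjoint sets (`sum_lambdaNorm_rpow_le`) bounds the ℓ^r sum of
the ‖fχ_Q‖ by (∫_0^τ (f^*)^α b)^{1/α}. Lower bound: for each h a radially decreasing f has f^* ≤
(h^*)^{1/α} and [T_{u,b}h^*(t)]^{1/α} ≤ C (M f)^*(t), by testing M on centred cubes
(`exists_supHardy_le_rearr_genMaximal`). The theorem follows by inserting h = |f|^α in one direction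
and the radial f in the other. -/

/-! ### Rearrangements and distribution functions -/

/-- Right-continuity of the distribution function. Continuity from below along a directed countable
union holds for arbitrary sets, so `g` need not be measurable. -/
theorem exists_lt_measure_superlevel {β : Type*} [MeasurableSpace β] {μ : Measure β}
    {g : β → ℝ≥0∞} {c m : ℝ≥0∞} (h : m < μ {x | c < g x}) :
    ∃ c', c < c' ∧ m < μ {x | c' < g x} := by
  rcases eq_or_ne c ∞ with rfl | hc
  · simp at h
  obtain ⟨u, hu, huc, hlim⟩ := exists_seq_strictAnti_tendsto' (lt_top_iff_ne_top.2 hc)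
  have hU : {x | c < g x} = ⋃ k, {x | u k < g x} := by
    ext x
    simp only [mem_ofPred_eq, mem_iUnion]
    exact ⟨fun hx => (hlim.eventually (gt_mem_nhds hx)).exists,
      fun ⟨k, hk⟩ => (huc k).1.trans hk⟩
  have hd : Directed (· ⊆ ·) fun k => {x | u k < g x} :=
    (monotone_nat_of_le_succ fun k x hx =>
      (hu.antitone k.le_succ).trans_lt hx : Monotone fun k => {x | u k < g x}).directed_le
  rw [hU, hd.measure_iUnion, lt_iSup_iff] at h
  obtain ⟨k, hk⟩ := h
  exact ⟨u k, (huc k).1, hk⟩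

section Rearrangement

variable {n : ℕ}

theorem lt_rearr_iff {g : (Fin n → ℝ) → ℝ≥0∞} {c : ℝ≥0∞} {t : ℝ} :
    c < rearr g t ↔ ENNReal.ofReal t < volume {x | c < g x} := by
  constructor
  · intro h
    by_contra! h'
    exact h.not_ge (sInf_le h')
  · intro h
    obtain ⟨c', hc, h'⟩ := exists_lt_measure_superlevel h
    refine hc.trans_le (le_sInf fun d hd => ?_)
    by_contra! hlt
    exact (h'.trans_le ((measure_mono fun x hx => hlt.trans hx).trans hd)).false

theorem rearr_antitone (g : (Fin n → ℝ) → ℝ≥0∞) : Antitone (rearr g) := fun _ _ hst =>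
  sInf_le_sInf fun _ hc => le_trans hc (ENNReal.ofReal_le_ofReal hst)

theorem rearr_mono {f g : (Fin n → ℝ) → ℝ≥0∞} (h : f ≤ g) (t : ℝ) : rearr f t ≤ rearr g t :=
  sInf_le_sInf fun _ hc => le_trans (measure_mono fun x hx => lt_of_lt_of_le hx (h x)) hc

theorem measurable_rearr (g : (Fin n → ℝ) → ℝ≥0∞) : Measurable (rearr g) :=
  (rearr_antitone g).measurable

theorem rearr_rpow (g : (Fin n → ℝ) → ℝ≥0∞) {a : ℝ} (ha : 0 < a) (t : ℝ) :
    rearr (fun x => g x ^ a) t = rearr g t ^ a := by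
  refine eq_of_forall_lt_iff fun c => ?_
  have key : ∀ d : ℝ≥0∞, c < d ^ a ↔ c ^ a⁻¹ < d := fun d => by
    rw [← ENNReal.rpow_inv_lt_iff ha]
  rw [key, lt_rearr_iff, lt_rearr_iff]
  simp only [key]

theorem rearr_eq_zero_of_support {g : (Fin n → ℝ) → ℝ≥0∞} {s : Set (Fin n → ℝ)}
    (hg : ∀ x, x ∉ s → g x = 0) {t : ℝ} (ht : volume s ≤ ENNReal.ofReal t) : rearr g t = 0 := by
  refine le_antisymm (sInf_le ((measure_mono fun x hx => ?_).trans ht)) bot_le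
  by_contra hxs
  simp [hg x hxs] at hx

end Rearrangement

/-! ### Layer-cake formula for the Lorentz functional -/

theorem lintegral_indicator_superlevel (a : ℝ≥0∞) :
    ∫⁻ c in Ioi (0 : ℝ), {c : ℝ | ENNReal.ofReal c < a}.indicator 1 c = a := by
  have hm : MeasurableSet {c : ℝ | ENNReal.ofReal c < a} :=
    measurableSet_lt ENNReal.measurable_ofReal measurable_const
  rw [lintegral_indicator_one hm, Measure.restrict_apply hm]
  induction a with
  | top =>
    simp
  | coe a =>
    have : {c : ℝ | ENNReal.ofReal c < a} ∩ Ioi 0 = Ioo 0 (a : ℝ) := by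
      ext c
      simp only [mem_inter_iff, mem_ofPred_eq, mem_Ioi, mem_Ioo]
      constructor
      · rintro ⟨h, h0⟩
        refine ⟨h0, ?_⟩
        rw [← ENNReal.ofReal_coe_nnreal] at h
        exact (ENNReal.ofReal_lt_ofReal_iff_of_nonneg h0.le).1 h
      · rintro ⟨h0, h⟩
        refine ⟨?_, h0⟩
        rw [← ENNReal.ofReal_coe_nnreal]
        exact (ENNReal.ofReal_lt_ofReal_iff_of_nonneg h0.le).2 h
    rw [this, Real.volume_Ioo]
    simp

/-- The mass that the weight `b` gives to the points `s > 0` below `m`. -/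
noncomputable def weightMass (b : ℝ → ℝ) (m : ℝ≥0∞) : ℝ≥0∞ :=
  ∫⁻ s in {s : ℝ | 0 < s ∧ ENNReal.ofReal s < m}, ENNReal.ofReal (b s)

theorem weightMass_mono (b : ℝ → ℝ) : Monotone (weightMass b) := fun _ _ h =>
  lintegral_mono_set fun _ hs => ⟨hs.1, hs.2.trans_le h⟩

theorem weightMass_zero (b : ℝ → ℝ) : weightMass b 0 = 0 := by simp [weightMass]

theorem weightMass_of_ne_top (b : ℝ → ℝ) {m : ℝ≥0∞} (hm : m ≠ ∞) :
    weightMass b m = weightPrimitive b m.toReal := by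
  have : {s : ℝ | 0 < s ∧ ENNReal.ofReal s < m} = Ioo 0 m.toReal := by
    ext s
    simp only [mem_ofPred_eq, mem_Ioo]
    refine and_congr_right fun hs => ?_
    rw [ENNReal.ofReal_lt_iff_lt_toReal hs.le hm]
  rw [weightMass, weightPrimitive, this]

theorem IsWeight.aemeasurable {b : ℝ → ℝ} (hb : IsWeight b) :
    AEMeasurable (fun s => ENNReal.ofReal (b s)) (volume.restrict (Ioi 0)) :=
  hb.2.aestronglyMeasurable.aemeasurable.ennreal_ofReal

/-- Layer cake and Tonelli, the sections being identified by `lt_rearr_iff`. The right side involves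
only distribution functions, which, unlike rearrangements, add up over disjoint sets. -/
theorem lintegral_rearr_mul_weight {n : ℕ} {b : ℝ → ℝ} (hb : IsWeight b)
    (g : (Fin n → ℝ) → ℝ≥0∞) :
    ∫⁻ s in Ioi (0 : ℝ), rearr g s * ENNReal.ofReal (b s) =
      ∫⁻ c in Ioi (0 : ℝ), weightMass b (volume {x | ENNReal.ofReal c < g x}) := by
  have hS : MeasurableSet {p : ℝ × ℝ | ENNReal.ofReal p.2 < rearr g p.1} :=
    measurableSet_lt (ENNReal.measurable_ofReal.comp measurable_snd)
      ((measurable_rearr g).comp measurable_fst)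
  set F : ℝ → ℝ → ℝ≥0∞ := fun s c =>
    {c : ℝ | ENNReal.ofReal c < rearr g s}.indicator 1 c * ENNReal.ofReal (b s) with hF
  have hFm : AEMeasurable (Function.uncurry F)
      ((volume.restrict (Ioi (0 : ℝ))).prod (volume.restrict (Ioi (0 : ℝ)))) := by
    have h1 : Measurable fun p : ℝ × ℝ =>
        {p : ℝ × ℝ | ENNReal.ofReal p.2 < rearr g p.1}.indicator (1 : ℝ × ℝ → ℝ≥0∞) p :=
      measurable_one.indicator hS
    exact h1.aemeasurable.mul (hb.aemeasurable.comp_quasiMeasurePreserving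
      Measure.quasiMeasurePreserving_fst)
  calc ∫⁻ s in Ioi (0 : ℝ), rearr g s * ENNReal.ofReal (b s)
      = ∫⁻ s in Ioi (0 : ℝ), ∫⁻ c in Ioi (0 : ℝ), F s c := by
        refine lintegral_congr fun s => ?_
        rw [hF, lintegral_mul_const' _ _ ENNReal.ofReal_ne_top, lintegral_indicator_superlevel]
    _ = ∫⁻ c in Ioi (0 : ℝ), ∫⁻ s in Ioi (0 : ℝ), F s c := lintegral_lintegral_swap hFm
    _ = _ := by
        refine lintegral_congr fun c => ?_
        have hm : MeasurableSet
            {s : ℝ | ENNReal.ofReal s < volume {x | ENNReal.ofReal c < g x}} :=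
          measurableSet_lt ENNReal.measurable_ofReal measurable_const
        have : ∀ s, F s c = {s : ℝ | ENNReal.ofReal s <
            volume {x | ENNReal.ofReal c < g x}}.indicator (fun s => ENNReal.ofReal (b s)) s := by
          intro s
          simp only [hF, indicator, mem_ofPred_eq, lt_rearr_iff]
          split_ifs <;> simp
        simp_rw [this]
        rw [lintegral_indicator hm, Measure.restrict_restrict hm, weightMass]
        congr 2
        ext s
        simp [and_comm]

/-! ### The lower r-estimate -/

/-- With S = ∑ d_i, the growth condition gives W(d_i) ≤ K ((d_i/S) W(S))^q W(S)^{1-q}. Hölder's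
inequality separates the two factors; after raising to the power 1/q the first is linear in d_i/S,
and these quotients sum to at most 1. -/
theorem sum_rpow_lintegral_comp_le {ι : Type*} (s : Finset ι) {W : ℝ≥0∞ → ℝ≥0∞}
    (hW : Monotone W) {q : ℝ} (hq0 : 0 < q) (hq1 : q ≤ 1) {K : ℝ≥0∞}
    (hWK : ∀ m M, m ≤ M → M ≠ ∞ → W m ≤ K * ((m / M) ^ q * W M)) (ν : Measure ℝ)
    {d : ι → ℝ → ℝ≥0∞} (hd : ∀ i ∈ s, Antitone (d i)) (hd' : ∀ i ∈ s, ∀ c, d i c ≠ ∞) :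
    ∑ i ∈ s, (∫⁻ c, W (d i c) ∂ν) ^ q⁻¹ ≤ (K * ∫⁻ c, W (∑ i ∈ s, d i c) ∂ν) ^ q⁻¹ := by
  set S : ℝ → ℝ≥0∞ := fun c => ∑ i ∈ s, d i c with hS
  have hSanti : Antitone S := fun c c' h => Finset.sum_le_sum fun i hi => hd i hi h
  have hStop : ∀ c, S c ≠ ∞ := fun c => ENNReal.sum_ne_top.2 fun i hi => hd' i hi c
  have hWS : Measurable fun c => W (S c) := (hW.comp_antitone hSanti).measurable
  set D := ∫⁻ c, W (S c) ∂ν with hD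
  have hθ : ∀ i ∈ s, Measurable fun c => d i c / S c * W (S c) := fun i hi =>
    ((hd i hi).measurable.div hSanti.measurable).mul hWS
  have hi : ∀ i ∈ s, (∫⁻ c, W (d i c) ∂ν) ^ q⁻¹ ≤
      K ^ q⁻¹ * ((∫⁻ c, d i c / S c * W (S c) ∂ν) * D ^ (q⁻¹ - 1)) := by
    intro i hi
    have h1 : ∫⁻ c, W (d i c) ∂ν ≤
        K * ((∫⁻ c, d i c / S c * W (S c) ∂ν) ^ q * D ^ (1 - q)) := by
      calc ∫⁻ c, W (d i c) ∂ν ≤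
            ∫⁻ c, K * ((d i c / S c * W (S c)) ^ q * W (S c) ^ (1 - q)) ∂ν := by
            refine lintegral_mono fun c => ?_
            refine (hWK _ _ (Finset.single_le_sum (f := fun i => d i c)
              (fun _ _ => bot_le) hi) (hStop c)).trans_eq ?_
            rw [ENNReal.mul_rpow_of_nonneg _ _ hq0.le, mul_assoc,
              ← ENNReal.rpow_add_of_nonneg _ _ hq0.le (sub_nonneg.2 hq1)]
            simp [hS]
        _ = K * ∫⁻ c, (d i c / S c * W (S c)) ^ q * W (S c) ^ (1 - q) ∂ν :=
            lintegral_const_mul _ (((hθ i hi).pow_const _).mul (hWS.pow_const _))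
        _ ≤ _ := by
            gcongr
            exact ENNReal.lintegral_mul_norm_pow_le (hθ i hi).aemeasurable hWS.aemeasurable
              hq0.le (sub_nonneg.2 hq1) (by ring)
    refine (ENNReal.rpow_le_rpow h1 (inv_nonneg.2 hq0.le)).trans_eq ?_
    rw [ENNReal.mul_rpow_of_nonneg _ _ (inv_nonneg.2 hq0.le),
      ENNReal.mul_rpow_of_nonneg _ _ (inv_nonneg.2 hq0.le), ← ENNReal.rpow_mul,
      ← ENNReal.rpow_mul, mul_inv_cancel₀ hq0.ne', ENNReal.rpow_one, sub_mul,
      mul_inv_cancel₀ hq0.ne', one_mul]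
  refine (Finset.sum_le_sum hi).trans ?_
  rw [← Finset.mul_sum, ← Finset.sum_mul, ENNReal.mul_rpow_of_nonneg _ _ (inv_nonneg.2 hq0.le)]
  gcongr
  have hsum : ∑ i ∈ s, ∫⁻ c, d i c / S c * W (S c) ∂ν ≤ D := by
    rw [← lintegral_finsetSum _ hθ]
    refine lintegral_mono fun c => ?_
    simp only [div_eq_mul_inv]
    rw [← Finset.sum_mul, ← Finset.sum_mul]
    -- Only an inequality: the quotient is 0 where `S c = 0`.
    calc (∑ i ∈ s, d i c) * (S c)⁻¹ * W (S c) ≤ 1 * W (S c) := by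
          gcongr
          exact ENNReal.mul_inv_le_one (S c)
      _ = _ := one_mul _
  calc (∑ i ∈ s, ∫⁻ c, d i c / S c * W (S c) ∂ν) * D ^ (q⁻¹ - 1) ≤ D * D ^ (q⁻¹ - 1) := by
        gcongr
    _ = D ^ q⁻¹ := by
        conv_lhs => rw [← ENNReal.rpow_one D, ← ENNReal.rpow_mul, one_mul]
        rw [← ENNReal.rpow_add_of_nonneg _ _ zero_le_one
          (sub_nonneg.2 ((one_le_inv₀ hq0).2 hq1))]
        simp

theorem weightMass_le_of_quasiIncreasing {b : ℝ → ℝ}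
    (hB : ∀ t, 0 < t → weightPrimitive b t < ∞) {q : ℝ}
    (h : QuasiIncreasing fun t => (weightPrimitive b t).toReal / t ^ q) :
    ∃ K : ℝ≥0∞, K ≠ ∞ ∧ ∀ m M, m ≤ M → M ≠ ∞ →
      weightMass b m ≤ K * ((m / M) ^ q * weightMass b M) := by
  obtain ⟨K, hK, h⟩ := h
  refine ⟨ENNReal.ofReal K, ENNReal.ofReal_ne_top, fun m M hmM hM => ?_⟩
  rcases eq_or_ne m 0 with rfl | hm
  · simp [weightMass_zero]
  have hm' : m ≠ ∞ := ne_top_of_le_ne_top hM hmM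
  have hm0 : 0 < m.toReal := ENNReal.toReal_pos hm hm'
  have hmMr : m.toReal ≤ M.toReal := ENNReal.toReal_mono hM hmM
  have hM0 : 0 < M.toReal := hm0.trans_le hmMr
  have key := h _ _ hm0 hmMr
  rw [weightMass_of_ne_top b hm', weightMass_of_ne_top b hM,
    ← ENNReal.ofReal_toReal (hB _ hm0).ne, ← ENNReal.ofReal_toReal (hB _ hM0).ne]
  have hdiv : m / M = ENNReal.ofReal (m.toReal / M.toReal) := by
    rw [ENNReal.ofReal_div_of_pos hM0, ENNReal.ofReal_toReal hm', ENNReal.ofReal_toReal hM]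
  rw [hdiv, ENNReal.ofReal_rpow_of_pos (by positivity),
    ← ENNReal.ofReal_mul (by positivity), ← ENNReal.ofReal_mul hK.le]
  refine ENNReal.ofReal_le_ofReal ?_
  rw [div_le_iff₀ (by positivity)] at key
  refine key.trans_eq ?_
  rw [Real.div_rpow hm0.le hM0.le]
  ring

theorem lambdaNorm_eq {n : ℕ} {b : ℝ → ℝ} (hb : IsWeight b) {α : ℝ} (hα : 0 < α)
    (g : (Fin n → ℝ) → ℝ≥0∞) :
    lambdaNorm α b g = (∫⁻ c in Ioi (0 : ℝ),
      weightMass b (volume {x | ENNReal.ofReal c < g x ^ α})) ^ (1 / α) := by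
  simp_rw [lambdaNorm, ← rearr_rpow g hα]
  rw [lintegral_rearr_mul_weight hb]

theorem abs_indicator {β : Type*} (s : Set β) (f : β → EReal) (x : β) :
    (s.indicator f x).abs = s.indicator (fun x => (f x).abs) x := by
  by_cases hx : x ∈ s <;> simp [hx]

/-- Lower `r`-estimate for the Lorentz functional, over disjoint sets. -/
theorem sum_lambdaNorm_rpow_le {n : ℕ} {ι : Type*} (s : Finset ι) {b : ℝ → ℝ} (hb : IsWeight b)
    {α r : ℝ} (hα : 0 < α) (hαr : α ≤ r) {K : ℝ≥0∞}
    (hK : ∀ m M, m ≤ M → M ≠ ∞ →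
      weightMass b m ≤ K * ((m / M) ^ (α / r) * weightMass b M))
    (f : (Fin n → ℝ) → EReal) {Q : ι → Set (Fin n → ℝ)} (hQ : ∀ i ∈ s, MeasurableSet (Q i))
    (hQfin : ∀ i ∈ s, volume (Q i) ≠ ∞) (hdisj : (s : Set ι).PairwiseDisjoint Q) :
    ∑ i ∈ s, lambdaNorm α b (modulus ((Q i).indicator f)) ^ r ≤
      (K * ∫⁻ y in Ioo 0 (∑ i ∈ s, volume (Q i)).toReal,
        rearr (modulus f) y ^ α * ENNReal.ofReal (b y)) ^ (r / α) := by
  have hr : 0 < r := hα.trans_le hαr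
  set U : Set (Fin n → ℝ) := ⋃ i ∈ s, Q i with hU
  have hlev : ∀ (V : Set (Fin n → ℝ)) (c : ℝ), 0 ≤ c →
      {x | ENNReal.ofReal c < modulus (V.indicator f) x ^ α} =
        {x | ENNReal.ofReal c < modulus f x ^ α} ∩ V := by
    intro V c hc
    ext x
    by_cases hx : x ∈ V <;> simp [modulus, hx, hα]
  have hmain := sum_rpow_lintegral_comp_le s (weightMass_mono b) (div_pos hα hr)
    ((div_le_one hr).2 hαr) hK (volume.restrict (Ioi 0)) (d := fun i c =>
      volume ({x | ENNReal.ofReal c < modulus f x ^ α} ∩ Q i))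
    (fun i _ => fun c c' h => measure_mono fun x hx =>
      ⟨(ENNReal.ofReal_le_ofReal h).trans_lt hx.1, hx.2⟩)
    (fun i hi c => ne_top_of_le_ne_top (hQfin i hi) (measure_mono inter_subset_right))
  rw [inv_div] at hmain
  have hleft : ∀ i ∈ s, lambdaNorm α b (modulus ((Q i).indicator f)) ^ r =
      (∫⁻ c in Ioi (0 : ℝ), weightMass b
        (volume ({x | ENNReal.ofReal c < modulus f x ^ α} ∩ Q i))) ^ (r / α) := by
    intro i _
    rw [lambdaNorm_eq hb hα, ← ENNReal.rpow_mul, one_div_mul_eq_div]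
    congr 1
    refine setLIntegral_congr_fun measurableSet_Ioi fun c hc => ?_
    rw [hlev _ _ (le_of_lt hc)]
  rw [Finset.sum_congr rfl hleft]
  refine hmain.trans (ENNReal.rpow_le_rpow (mul_le_mul' le_rfl ?_) (by positivity))
  have hright : ∫⁻ c in Ioi (0 : ℝ), weightMass b (∑ i ∈ s,
      volume ({x | ENNReal.ofReal c < modulus f x ^ α} ∩ Q i)) =
      ∫⁻ y in Ioi (0 : ℝ), rearr (modulus (U.indicator f)) y ^ α * ENNReal.ofReal (b y) := by
    simp_rw [← rearr_rpow _ hα]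
    rw [lintegral_rearr_mul_weight hb]
    refine setLIntegral_congr_fun measurableSet_Ioi fun c hc => ?_
    rw [hlev _ _ (le_of_lt hc)]
    congr 1
    -- Restricting the measure to the level set makes additivity depend on measurability of the `Q
    -- i` alone, so `f` stays arbitrary.
    have := measure_biUnion_finset (μ := volume.restrict {x | ENNReal.ofReal c < modulus f x ^ α})
      hdisj hQ
    rw [Measure.restrict_apply (Finset.measurableSet_biUnion s hQ), inter_comm, ← hU] at this
    rw [this]
    refine Finset.sum_congr rfl fun i hi => ?_
    rw [Measure.restrict_apply (hQ i hi), inter_comm]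
  rw [hright]
  have hvolU : volume U ≤ ∑ i ∈ s, volume (Q i) := measure_biUnion_finset_le s Q
  have htop : ∑ i ∈ s, volume (Q i) ≠ ∞ := ENNReal.sum_ne_top.2 hQfin
  set T := ∑ i ∈ s, volume (Q i) with hT
  -- The rearrangement of fχ_U is at most f^* and vanishes from |U| ≤ T on.
  rw [← lintegral_indicator measurableSet_Ioi, ← lintegral_indicator measurableSet_Ioo]
  refine lintegral_mono fun y => ?_
  by_cases hy : y ∈ Ioi (0 : ℝ)
  · rw [indicator_of_mem hy]
    by_cases hyT : y < T.toReal
    · rw [indicator_of_mem (show y ∈ Ioo 0 T.toReal from ⟨hy, hyT⟩)]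
      gcongr
      refine rearr_mono (fun x => ?_) y
      rw [modulus, abs_indicator]
      exact indicator_le_self' (fun _ _ => bot_le) x
    · rw [rearr_eq_zero_of_support (s := U) (fun x hx => by simp [modulus, hx]) ?_,
        ENNReal.zero_rpow_of_pos hα, zero_mul]
      · exact bot_le
      · rw [← ENNReal.ofReal_toReal htop] at hvolU
        exact hvolU.trans (ENNReal.ofReal_le_ofReal (not_lt.1 hyT))
  · rw [indicator_of_notMem hy]
    exact bot_le

/-! ### Growth of φ, and the covering by cubes -/

theorem QCondition.exists_ofReal_sum_le {r : ℝ} {φ : ℝ → ℝ} (h : QCondition r φ)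
    (hφ : ∀ t, 0 < t → 0 < φ t) :
    ∃ C : ℝ≥0∞, C ≠ ∞ ∧ ∀ {ι : Type} (s : Finset ι) (t : ι → ℝ), s.Nonempty →
      (∀ i ∈ s, 0 < t i) → ENNReal.ofReal (φ (∑ i ∈ s, t i)) ≤
        C * (∑ i ∈ s, ENNReal.ofReal (φ (t i)) ^ r) ^ (1 / r) := by
  obtain ⟨C, hC, h⟩ := h
  refine ⟨ENNReal.ofReal C, ENNReal.ofReal_ne_top, fun {ι} s t hs ht => ?_⟩
  have key := h s.card (fun i => t (s.equivFin.symm i)) (Finset.card_pos.2 hs)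
    (fun i => ht _ (s.equivFin.symm i).2)
  rw [Equiv.sum_comp s.equivFin.symm (fun i : s => t i), Finset.sum_coe_sort s t,
    Equiv.sum_comp s.equivFin.symm (fun i : s => φ (t i) ^ r),
    Finset.sum_coe_sort s fun i => φ (t i) ^ r] at key
  have hpos : ∀ i ∈ s, 0 < φ (t i) ^ r := fun i hi => Real.rpow_pos_of_pos (hφ _ (ht i hi)) r
  refine (ENNReal.ofReal_le_ofReal key).trans_eq ?_
  rw [ENNReal.ofReal_mul hC.le, ← ENNReal.ofReal_rpow_of_pos (Finset.sum_pos hpos hs),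
    ENNReal.ofReal_sum_of_nonneg fun i hi => (hpos i hi).le]
  congr 2
  exact Finset.sum_congr rfl fun i hi => (ENNReal.ofReal_rpow_of_pos (hφ _ (ht i hi))).symm

/-- Q_r applied to N equal points costs the factor N^{1/r}. This is the doubling of φ that absorbs
the dilations 5^n and 2 below. -/
theorem QCondition.exists_ofReal_mul_le {r : ℝ} (hr : 0 < r) {φ : ℝ → ℝ} (h : QCondition r φ)
    (hφ : ∀ t, 0 < t → 0 < φ t) {N : ℕ} (hN : 0 < N) :
    ∃ C : ℝ≥0∞, C ≠ ∞ ∧ ∀ t, 0 < t →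
      ENNReal.ofReal (φ (N * t)) ≤ C * ENNReal.ofReal (φ t) := by
  obtain ⟨C, hC, h⟩ := h.exists_ofReal_sum_le hφ
  refine ⟨C * (N : ℝ≥0∞) ^ (1 / r), ENNReal.mul_ne_top hC (by simp [hr.le]), fun t ht => ?_⟩
  have := h (Finset.range N) (fun _ => t) (by simpa using hN.ne') (fun _ _ => ht)
  simp only [Finset.sum_const, Finset.card_range, nsmul_eq_mul] at this
  refine this.trans_eq ?_
  rw [ENNReal.mul_rpow_of_nonneg _ _ (by positivity), ← ENNReal.rpow_mul,
    mul_one_div_cancel hr.ne', ENNReal.rpow_one, mul_assoc]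

section Cubes

variable {n : ℕ}

theorem openCube_eq_pi (a : Fin n → ℝ) (l : ℝ) :
    openCube a l = univ.pi fun i => Ioo (a i) (a i + l) := by
  ext x
  simp [openCube]

theorem isOpen_openCube (a : Fin n → ℝ) (l : ℝ) : IsOpen (openCube a l) := by
  rw [openCube_eq_pi]
  exact isOpen_set_pi finite_univ fun _ _ => isOpen_Ioo

theorem volume_openCube (a : Fin n → ℝ) (l : ℝ) :
    volume (openCube a l) = ENNReal.ofReal l ^ n := by
  rw [openCube_eq_pi, Real.volume_pi_Ioo]
  simp

/-- A cube of side at most 2l' meeting a cube of side l' sticks out by at most 2l' on each side,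
whence 2l' + l' + 2l' = 5l'. -/
theorem openCube_subset_of_inter_nonempty {a a' : Fin n → ℝ} {l l' : ℝ}
    (h : (openCube a l ∩ openCube a' l').Nonempty) (hl : l ≤ 2 * l') :
    openCube a l ⊆ openCube (fun i => a' i - 2 * l') (5 * l') := by
  obtain ⟨z, hz, hz'⟩ := h
  intro x hx i
  have h1 := hz i
  have h2 := hz' i
  have h3 := hx i
  constructor <;> linarith

theorem exists_disjoint_cubes_volume_le {s : Finset ((Fin n → ℝ) × ℝ)} (hs : ∀ p ∈ s, 0 < p.2)
    (hne : ∀ p ∈ s, (openCube p.1 p.2).Nonempty) {K : Set (Fin n → ℝ)}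
    (hK : K ⊆ ⋃ p ∈ s, openCube p.1 p.2) :
    ∃ u ⊆ s, (u : Set ((Fin n → ℝ) × ℝ)).PairwiseDisjoint (fun p => openCube p.1 p.2) ∧
      volume K ≤ (5 ^ n : ℕ) * ∑ p ∈ u, volume (openCube p.1 p.2) := by
  classical
  obtain ⟨R, hR⟩ := (s.image Prod.snd).bddAbove
  obtain ⟨u, hus, hdisj, hcov⟩ := Vitali.exists_disjoint_subfamily_covering_enlargement
    (fun p : (Fin n → ℝ) × ℝ => openCube p.1 p.2) s Prod.snd 2 one_lt_two
    (fun p hp => (hs p hp).le) R (fun p hp => hR (by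
      simpa using ⟨p.1, hp⟩)) hne
  have hufin : u.Finite := s.finite_toSet.subset hus
  refine ⟨hufin.toFinset, by simpa using hus, by simpa using hdisj, ?_⟩
  have hsub : K ⊆ ⋃ p ∈ hufin.toFinset, openCube (fun i => p.1 i - 2 * p.2) (5 * p.2) := by
    intro x hx
    obtain ⟨p, hp, hxp⟩ := mem_iUnion₂.1 (hK hx)
    obtain ⟨p', hp', hint, hle⟩ := hcov p hp
    exact mem_iUnion₂.2 ⟨p', by simpa using hp', openCube_subset_of_inter_nonempty hint hle hxp⟩
  refine (measure_mono hsub).trans ((measure_biUnion_finset_le _ _).trans_eq ?_)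
  rw [Finset.mul_sum]
  refine Finset.sum_congr rfl fun p hp => ?_
  rw [volume_openCube, volume_openCube, ENNReal.ofReal_mul (by norm_num), mul_pow]
  simp

theorem lt_genMaximal_iff {φ : ℝ → ℝ} {α : ℝ} {b : ℝ → ℝ} {f : (Fin n → ℝ) → EReal}
    {x : Fin n → ℝ} {c : ℝ≥0∞} :
    c < genMaximal φ α b f x ↔ ∃ a l, 0 < l ∧ x ∈ openCube a l ∧
      c < lambdaNorm α b (modulus ((openCube a l).indicator f)) /
        ENNReal.ofReal (φ (volume (openCube a l)).toReal) := by
  simp only [genMaximal, lt_iSup_iff, exists_prop]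

end Cubes

/-! ### Upper bound for the rearrangement of the maximal function -/

theorem supHardy_term {b : ℝ → ℝ} {τ : ℝ}
    (hB : 0 < weightPrimitive b τ ∧ weightPrimitive b τ < ∞) (P D : ℝ≥0∞) :
    weightPrimitive b τ / P / weightPrimitive b τ * D = D / P := by
  rw [div_eq_mul_inv, div_eq_mul_inv, mul_right_comm (weightPrimitive b τ), ENNReal.mul_inv_cancel hB.1.ne' hB.2.ne,
    one_mul, mul_comm, div_eq_mul_inv]

theorem exists_rearr_genMaximal_le {n : ℕ} {α r : ℝ} (hα : 0 < α) (hαr : α ≤ r) {φ : ℝ → ℝ}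
    (hφ_pos : ∀ t, 0 < t → 0 < φ t) (hφ_Q : QCondition r φ) {b : ℝ → ℝ} (hb : IsWeight b)
    (hB : ∀ t, 0 < t → 0 < weightPrimitive b t ∧ weightPrimitive b t < ∞)
    (hB_qi : QuasiIncreasing (fun t => (weightPrimitive b t).toReal / t ^ (α / r))) :
    ∃ C : ℝ≥0∞, C ≠ ∞ ∧ ∀ (f : (Fin n → ℝ) → EReal) (t : ℝ), 0 < t →
      rearr (genMaximal φ α b f) t ≤
        C * supHardy (fun τ => weightPrimitive b τ / ENNReal.ofReal (φ τ) ^ α) b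
          (fun y => rearr (modulus f) y ^ α) t ^ (1 / α) := by
  have hr : 0 < r := hα.trans_le hαr
  obtain ⟨C₁, hC₁, h₁⟩ := hφ_Q.exists_ofReal_sum_le hφ_pos
  have hN : 0 < 5 ^ n := by positivity
  obtain ⟨C₂, hC₂, h₂⟩ := hφ_Q.exists_ofReal_mul_le hr hφ_pos hN
  obtain ⟨K, hK, h₃⟩ := weightMass_le_of_quasiIncreasing (fun t ht => (hB t ht).2) hB_qi
  refine ⟨C₂ * (C₁ * K ^ (1 / α)), ENNReal.mul_ne_top hC₂ (ENNReal.mul_ne_top hC₁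
    (ENNReal.rpow_ne_top_of_nonneg (by positivity) hK)), fun f t ht => ?_⟩
  refine le_of_forall_lt_imp_le_of_dense fun c hc => ?_
  rw [lt_rearr_iff] at hc
  set q : (Fin n → ℝ) × ℝ → ℝ≥0∞ := fun p =>
    lambdaNorm α b (modulus ((openCube p.1 p.2).indicator f)) /
      ENNReal.ofReal (φ (volume (openCube p.1 p.2)).toReal) with hq
  set I : Set ((Fin n → ℝ) × ℝ) := {p | 0 < p.2 ∧ c < q p} with hI
  have hE : {x | c < genMaximal φ α b f x} ⊆ ⋃ p ∈ I, openCube p.1 p.2 := by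
    intro x hx
    obtain ⟨a, l, hl, hxl, hcl⟩ := lt_genMaximal_iff.1 hx
    exact mem_iUnion₂.2 ⟨(a, l), ⟨hl, hcl⟩, hxl⟩
  -- The union of cubes is open, so inner regularity supplies a compact set of measure above t,
  -- hence a finite subcover.
  obtain ⟨A, hAsub, hA, htA⟩ := (isOpen_biUnion fun (p : (Fin n → ℝ) × ℝ) (_ : p ∈ I) =>
    isOpen_openCube p.1 p.2).exists_lt_isCompact (hc.trans_le (measure_mono hE))
  obtain ⟨I', hI'I, hI'fin, hAI'⟩ := hA.elim_finite_subcover_image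
    (fun p _ => isOpen_openCube p.1 p.2) hAsub
  have hpos : ∀ p ∈ I, 0 < (volume (openCube p.1 p.2)).toReal := fun p hp => by
    rw [volume_openCube, ENNReal.toReal_pow, ENNReal.toReal_ofReal hp.1.le]
    exact pow_pos hp.1 n
  obtain ⟨u, hu, hdisj, hvol⟩ := exists_disjoint_cubes_volume_le (s := hI'fin.toFinset)
    (fun p hp => (hI'I (hI'fin.mem_toFinset.1 hp)).1)
    (fun p hp => nonempty_of_measure_ne_zero (μ := volume)
      (ENNReal.toReal_pos_iff.1 (hpos p (hI'I (hI'fin.mem_toFinset.1 hp)))).1.ne')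
    (by simpa using hAI')
  have huI : ∀ p ∈ u, p ∈ I := fun p hp => hI'I (hI'fin.mem_toFinset.1 (hu hp))
  have hfin : ∀ p ∈ u, volume (openCube p.1 p.2) ≠ ∞ := fun p _ => by
    rw [volume_openCube]
    exact ENNReal.pow_ne_top ENNReal.ofReal_ne_top
  have hsumtop : ∑ p ∈ u, volume (openCube p.1 p.2) ≠ ∞ := ENNReal.sum_ne_top.2 hfin
  have hune : u.Nonempty := by
    rw [Finset.nonempty_iff_ne_empty]
    rintro rfl
    simp only [Finset.sum_empty, mul_zero, nonpos_iff_eq_zero] at hvol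
    simp [hvol] at htA
  set τ := (∑ p ∈ u, volume (openCube p.1 p.2)).toReal with hτ
  have hτsum : τ = ∑ p ∈ u, (volume (openCube p.1 p.2)).toReal := ENNReal.toReal_sum hfin
  have hτ0 : 0 < τ := hτsum ▸ Finset.sum_pos (fun p hp => hpos p (huI p hp)) hune
  have htτ : t ≤ (5 ^ n : ℕ) * τ := by
    have := htA.le.trans hvol
    rw [← ENNReal.ofReal_toReal hsumtop, ← ENNReal.ofReal_natCast,
      ← ENNReal.ofReal_mul (by positivity), ENNReal.ofReal_le_ofReal_iff (by positivity)] at this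
    exact this
  set D : ℝ → ℝ≥0∞ := fun σ => ∫⁻ y in Ioo 0 σ, rearr (modulus f) y ^ α * ENNReal.ofReal (b y)
    with hD
  have hDτ : D τ ≤ D ((5 ^ n : ℕ) * τ) := lintegral_mono_set (Ioo_subset_Ioo_right
    (le_mul_of_one_le_left hτ0.le (by exact_mod_cast hN)))
  have hsum := sum_lambdaNorm_rpow_le u hb hα hαr h₃ f
    (fun p _ => (isOpen_openCube p.1 p.2).measurableSet) hfin hdisj
  rw [← hτ] at hsum
  -- Q_r from below and the lower r-estimate from above meet in the ℓ^r sum of c φ(|Q|) over the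
  -- disjoint cubes.
  have hcτ : c * ENNReal.ofReal (φ τ) ≤ C₁ * (K ^ (1 / α) * D τ ^ (1 / α)) := by
    calc c * ENNReal.ofReal (φ τ)
        ≤ c * (C₁ * (∑ p ∈ u,
            ENNReal.ofReal (φ (volume (openCube p.1 p.2)).toReal) ^ r) ^ (1 / r)) := by
          gcongr
          rw [hτsum]
          exact h₁ u _ hune fun p hp => hpos p (huI p hp)
      _ = C₁ * (∑ p ∈ u,
            (c * ENNReal.ofReal (φ (volume (openCube p.1 p.2)).toReal)) ^ r) ^ (1 / r) := by
          simp_rw [ENNReal.mul_rpow_of_nonneg _ _ hr.le]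
          rw [← Finset.mul_sum, ENNReal.mul_rpow_of_nonneg _ _ (by positivity : 0 ≤ 1 / r),
            ← ENNReal.rpow_mul, mul_one_div_cancel hr.ne', ENNReal.rpow_one]
          ring
      _ ≤ C₁ * (((K * D τ) ^ (r / α)) ^ (1 / r)) := by
          gcongr
          refine (Finset.sum_le_sum fun p hp => ?_).trans hsum
          gcongr
          exact ENNReal.mul_le_of_le_div (huI p hp).2.le
      _ = C₁ * (K ^ (1 / α) * D τ ^ (1 / α)) := by
          rw [← ENNReal.rpow_mul, ← ENNReal.mul_rpow_of_nonneg _ _ (by positivity)]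
          congr 2
          field_simp
  -- The supremum in T runs over arguments ≥ t, while only 5^n τ ≥ t is known; passing from τ to σ
  -- costs the doubling constant of φ.
  set σ : ℝ := (5 ^ n : ℕ) * τ with hσ
  have hσ0 : 0 < σ := ht.trans_le htτ
  have hcσ : c * ENNReal.ofReal (φ σ) ≤ C₂ * (C₁ * K ^ (1 / α)) * D σ ^ (1 / α) := by
    calc c * ENNReal.ofReal (φ σ) ≤ c * (C₂ * ENNReal.ofReal (φ τ)) := by
          gcongr
          exact h₂ τ hτ0
      _ = C₂ * (c * ENNReal.ofReal (φ τ)) := by ring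
      _ ≤ C₂ * (C₁ * (K ^ (1 / α) * D τ ^ (1 / α))) := by gcongr
      _ ≤ C₂ * (C₁ * (K ^ (1 / α) * D σ ^ (1 / α))) := by gcongr
      _ = _ := by ring
  have hφσ : ENNReal.ofReal (φ σ) ≠ 0 := by simpa using hφ_pos σ hσ0
  have hle : c ≤ C₂ * (C₁ * K ^ (1 / α)) * (D σ / ENNReal.ofReal (φ σ) ^ α) ^ (1 / α) := by
    rw [ENNReal.div_rpow_of_nonneg _ _ (by positivity), ← ENNReal.rpow_mul,
      mul_one_div_cancel hα.ne', ENNReal.rpow_one, ← mul_div_assoc]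
    exact (ENNReal.le_div_iff_mul_le (Or.inl hφσ) (Or.inl ENNReal.ofReal_ne_top)).2 hcσ
  refine hle.trans ?_
  gcongr
  rw [← supHardy_term (hB σ hσ0)]
  exact le_iSup₂_of_le σ htτ le_rfl

/-! ### Radial test functions and the lower bound -/

theorem measurable_ereal_abs : Measurable EReal.abs :=
  EReal.measurable_of_measurable_real (by
    simp only [EReal.abs_def]
    fun_prop)

theorem ereal_abs_coe_ennreal (a : ℝ≥0∞) : (a : EReal).abs = a := by
  induction a with
  | top => rfl
  | coe a =>
    change ((a : ℝ) : EReal).abs = a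
    rw [EReal.abs_def, abs_of_nonneg (NNReal.coe_nonneg a), ENNReal.ofReal_coe_nnreal]

section Radial

variable {n : ℕ}

/-- Balls of the sup norm are cubes, and (2‖x‖)^n is the volume of the one of radius ‖x‖. A
decreasing function of this quantity therefore has itself as rearrangement, up to its values at
jumps. -/
theorem volume_setOf_radial_lt (hn : 0 < n) {s : ℝ} (hs : 0 < s) :
    volume {x : Fin n → ℝ | (2 * ‖x‖) ^ n < s} = ENNReal.ofReal s := by
  set ρ := s ^ (1 / n : ℝ) / 2 with hρ
  have hρ0 : 0 < ρ := by positivity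
  have h2ρ : (2 * ρ) ^ n = s := by
    rw [hρ, mul_div_cancel₀ _ two_ne_zero, one_div, Real.rpow_inv_natCast_pow hs.le hn.ne']
  have : {x : Fin n → ℝ | (2 * ‖x‖) ^ n < s} = Metric.ball 0 ρ := by
    ext x
    rw [mem_ofPred_eq, ← h2ρ, pow_lt_pow_iff_left₀ (by positivity) (by positivity) hn.ne',
      mem_ball_zero_iff]
    exact mul_lt_mul_iff_right₀ two_pos
  rw [this, Real.volume_pi_ball _ hρ0, Fintype.card_fin, h2ρ]

theorem exists_openCube_eq_radial (hn : 0 < n) {τ : ℝ} (hτ : 0 < τ) :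
    ∃ (a : Fin n → ℝ) (l : ℝ), 0 < l ∧ openCube a l = {x | (2 * ‖x‖) ^ n < τ} := by
  set l := τ ^ (1 / n : ℝ) with hl
  have hl0 : 0 < l := by positivity
  refine ⟨fun _ => -(l / 2), l, hl0, ?_⟩
  have hln : l ^ n = τ := by
    rw [hl, one_div, Real.rpow_inv_natCast_pow hτ.le hn.ne']
  ext x
  rw [mem_ofPred_eq, ← hln, pow_lt_pow_iff_left₀ (by positivity) hl0.le hn.ne',
    show 2 * ‖x‖ < l ↔ ‖x‖ < l / 2 by constructor <;> intro h <;> linarith,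
    pi_norm_lt_iff (by positivity)]
  refine forall_congr' fun i => ?_
  rw [Real.norm_eq_abs, abs_lt]
  constructor <;> rintro ⟨h1, h2⟩ <;> constructor <;> linarith

/-- The radially decreasing function with rearrangement `(H^*)^{1/α}`. -/
noncomputable def radial (α : ℝ) (H : (Fin n → ℝ) → ℝ≥0∞) (x : Fin n → ℝ) : EReal :=
  ((rearr H ((2 * ‖x‖) ^ n) ^ (1 / α) : ℝ≥0∞) : EReal)

theorem modulus_radial (α : ℝ) (H : (Fin n → ℝ) → ℝ≥0∞) (x : Fin n → ℝ) :
    modulus (radial α H) x = rearr H ((2 * ‖x‖) ^ n) ^ (1 / α) :=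
  ereal_abs_coe_ennreal _

theorem measurable_radial (α : ℝ) (H : (Fin n → ℝ) → ℝ≥0∞) : Measurable (radial α H) := by
  have : Measurable fun x : Fin n → ℝ => (2 * ‖x‖) ^ n := by fun_prop
  exact measurable_coe_ennreal_ereal.comp (((measurable_rearr H).comp this).pow_const _)

theorem rearr_modulus_radial_le (hn : 0 < n) {α : ℝ} (hα : 0 < α) (H : (Fin n → ℝ) → ℝ≥0∞)
    {s : ℝ} (hs : 0 < s) : rearr (modulus (radial α H)) s ≤ rearr H s ^ (1 / α) := by
  refine sInf_le ((measure_mono fun x hx => ?_).trans_eq (volume_setOf_radial_lt hn hs))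
  by_contra! h
  simp only [mem_ofPred_eq, not_lt] at h
  rw [mem_ofPred_eq, modulus_radial] at hx
  exact hx.not_ge (ENNReal.rpow_le_rpow (rearr_antitone H h) (by positivity))

theorem exists_gt_lt_rearr {H : (Fin n → ℝ) → ℝ≥0∞} {c : ℝ≥0∞} {s : ℝ} (h : c < rearr H s) :
    ∃ s', s < s' ∧ c < rearr H s' := by
  rw [lt_rearr_iff] at h
  obtain ⟨s', hs', hs1, hs2⟩ := ENNReal.lt_iff_exists_real_btwn.1 h
  exact ⟨s', lt_of_not_ge fun h => hs1.not_ge (ENNReal.ofReal_le_ofReal h), lt_rearr_iff.2 hs2⟩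

/-- Cutting a radially decreasing function to the centred cube of volume τ removes only its smallest
values, leaving the rearrangement intact below τ. -/
theorem le_rearr_indicator_radial (hn : 0 < n) {α : ℝ} (hα : 0 < α) (H : (Fin n → ℝ) → ℝ≥0∞)
    {s τ : ℝ} (hs : 0 < s) (hsτ : s < τ) :
    rearr H s ^ (1 / α) ≤
      rearr (modulus ({x | (2 * ‖x‖) ^ n < τ}.indicator (radial α H))) s := by
  refine le_of_forall_lt fun c hc => ?_
  have key : ∀ d : ℝ≥0∞, c < d ^ (1 / α) ↔ c ^ α < d := fun d => by
    rw [one_div, ENNReal.lt_rpow_inv_iff hα]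
  -- The room between s and s' gives the strict measure inequality that `lt_rearr_iff` demands.
  obtain ⟨s', hss', hs'⟩ := exists_gt_lt_rearr ((key _).1 hc)
  have hmin : s < min s' τ := lt_min hss' hsτ
  rw [lt_rearr_iff]
  calc ENNReal.ofReal s < ENNReal.ofReal (min s' τ) :=
        (ENNReal.ofReal_lt_ofReal_iff_of_nonneg hs.le).2 hmin
    _ = volume {x : Fin n → ℝ | (2 * ‖x‖) ^ n < min s' τ} :=
        (volume_setOf_radial_lt hn (hs.trans hmin)).symm
    _ ≤ _ := measure_mono fun x hx => ?_
  rw [mem_ofPred_eq, lt_min_iff] at hx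
  rw [mem_ofPred_eq, modulus, indicator_of_mem (by exact hx.2)]
  exact ((key _).2 (hs'.trans_le (rearr_antitone H hx.1.le))).trans_eq
    (modulus_radial α H x).symm

/-- The centred cube of volume τ is admissible at each of its points, so the maximal function is at
least the left side on a set of measure τ > t. -/
theorem le_rearr_genMaximal_radial (hn : 0 < n) {α : ℝ} (hα : 0 < α) (φ b : ℝ → ℝ)
    (H : (Fin n → ℝ) → ℝ≥0∞) {t τ : ℝ} (ht : 0 < t) (htτ : t < τ) :
    (∫⁻ y in Ioo 0 τ, rearr H y * ENNReal.ofReal (b y)) ^ (1 / α) / ENNReal.ofReal (φ τ) ≤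
      rearr (genMaximal φ α b (radial α H)) t := by
  have hτ := ht.trans htτ
  obtain ⟨a, l, hl, hQ⟩ := exists_openCube_eq_radial hn hτ
  refine le_of_forall_lt fun c hc => ?_
  rw [lt_rearr_iff]
  calc ENNReal.ofReal t < ENNReal.ofReal τ :=
        (ENNReal.ofReal_lt_ofReal_iff_of_nonneg ht.le).2 htτ
    _ = volume {x : Fin n → ℝ | (2 * ‖x‖) ^ n < τ} := (volume_setOf_radial_lt hn hτ).symm
    _ ≤ _ := measure_mono fun x hx => ?_
  refine lt_genMaximal_iff.2 ⟨a, l, hl, hQ ▸ hx, hc.trans_le ?_⟩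
  rw [hQ, volume_setOf_radial_lt hn hτ, ENNReal.toReal_ofReal hτ.le]
  refine ENNReal.div_le_div_right (ENNReal.rpow_le_rpow ?_ (by positivity)) _
  refine (setLIntegral_mono' measurableSet_Ioo fun y hy => ?_).trans
    (lintegral_mono_set Ioo_subset_Ioi_self)
  gcongr
  have := ENNReal.rpow_le_rpow (le_rearr_indicator_radial hn hα H hy.1 hy.2) hα.le
  rwa [← ENNReal.rpow_mul, one_div_mul_cancel hα.ne', ENNReal.rpow_one] at this

end Radial

theorem exists_supHardy_le_rearr_genMaximal {n : ℕ} (hn : 0 < n) {α r : ℝ} (hα : 0 < α)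
    (hr : 0 < r) {φ : ℝ → ℝ} (hφ_pos : ∀ t, 0 < t → 0 < φ t) (hφ_Q : QCondition r φ)
    {b : ℝ → ℝ} (hB : ∀ t, 0 < t → 0 < weightPrimitive b t ∧ weightPrimitive b t < ∞) :
    ∃ C : ℝ≥0∞, C ≠ ∞ ∧ ∀ (H : (Fin n → ℝ) → ℝ≥0∞) (t : ℝ), 0 < t →
      supHardy (fun τ => weightPrimitive b τ / ENNReal.ofReal (φ τ) ^ α) b (rearr H) t ^ (1 / α) ≤
        C * rearr (genMaximal φ α b (radial α H)) t := by
  obtain ⟨C, hC, h⟩ := hφ_Q.exists_ofReal_mul_le hr hφ_pos two_pos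
  refine ⟨C, hC, fun H t ht => ?_⟩
  rw [one_div, ENNReal.rpow_inv_le_iff hα]
  refine iSup₂_le fun τ hτ => ?_
  have hτ0 := ht.trans_le hτ
  rw [supHardy_term (hB τ hτ0), ← ENNReal.rpow_inv_le_iff hα,
    ENNReal.div_rpow_of_nonneg _ _ (by positivity), ← ENNReal.rpow_mul, mul_inv_cancel₀ hα.ne',
    ENNReal.rpow_one, ← one_div]
  -- The supremum allows τ = t, where a set of measure τ is too small; the cube of volume 2τ is used
  -- instead, at the cost of doubling φ.
  have hM := le_rearr_genMaximal_radial hn hα φ b H ht (show t < 2 * τ by linarith)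
  have hφτ : ENNReal.ofReal (φ τ) ≠ 0 := by simpa using hφ_pos τ hτ0
  have hφ2τ : ENNReal.ofReal (φ (2 * τ)) ≠ 0 := by simpa using hφ_pos (2 * τ) (by linarith)
  rw [ENNReal.div_le_iff hφ2τ ENNReal.ofReal_ne_top] at hM
  rw [ENNReal.div_le_iff hφτ ENNReal.ofReal_ne_top]
  calc (∫⁻ y in Ioo 0 τ, rearr H y * ENNReal.ofReal (b y)) ^ (1 / α)
      ≤ (∫⁻ y in Ioo 0 (2 * τ), rearr H y * ENNReal.ofReal (b y)) ^ (1 / α) := by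
        refine ENNReal.rpow_le_rpow (lintegral_mono_set (Ioo_subset_Ioo_right ?_))
          (by positivity)
        linarith
    _ ≤ _ := hM
    _ ≤ rearr (genMaximal φ α b (radial α H)) t * (C * ENNReal.ofReal (φ τ)) := by
        gcongr
        exact_mod_cast h τ hτ0
    _ = _ := by ring

/-! ### Passage to the iterated norms -/

theorem iterated_lintegral_le_const_mul {p m : ℝ} (hp : 0 < p) (hm : 0 < m) (w : ℝ → ℝ)
    {F G : ℝ → ℝ≥0∞} {C : ℝ≥0∞} (hC : C ≠ ∞) (h : ∀ t, 0 < t → F t ≤ C * G t) :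
    (∫⁻ x in Ioi (0 : ℝ), (∫⁻ t in Ioo 0 x, F t ^ p) ^ (m / p) * ENNReal.ofReal (w x)) ^ (1 / m) ≤
      C * (∫⁻ x in Ioi (0 : ℝ),
        (∫⁻ t in Ioo 0 x, G t ^ p) ^ (m / p) * ENNReal.ofReal (w x)) ^ (1 / m) := by
  have hCm : C ^ m ≠ ∞ := ENNReal.rpow_ne_top_of_nonneg hm.le hC
  have hCp : C ^ p ≠ ∞ := ENNReal.rpow_ne_top_of_nonneg hp.le hC
  have hin : ∀ x, (∫⁻ t in Ioo 0 x, F t ^ p) ^ (m / p) ≤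
      C ^ m * (∫⁻ t in Ioo 0 x, G t ^ p) ^ (m / p) := by
    intro x
    calc (∫⁻ t in Ioo 0 x, F t ^ p) ^ (m / p)
        ≤ (∫⁻ t in Ioo 0 x, C ^ p * G t ^ p) ^ (m / p) := by
          refine ENNReal.rpow_le_rpow (setLIntegral_mono' measurableSet_Ioo fun t ht => ?_)
            (by positivity)
          rw [← ENNReal.mul_rpow_of_nonneg _ _ hp.le]
          exact ENNReal.rpow_le_rpow (h t ht.1) hp.le
      _ = _ := by
          rw [lintegral_const_mul' _ _ hCp, ENNReal.mul_rpow_of_nonneg _ _ (by positivity),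
            ← ENNReal.rpow_mul, mul_div_cancel₀ _ hp.ne']
  calc _ ≤ (∫⁻ x in Ioi (0 : ℝ), C ^ m * ((∫⁻ t in Ioo 0 x, G t ^ p) ^ (m / p) *
        ENNReal.ofReal (w x))) ^ (1 / m) := by
        refine ENNReal.rpow_le_rpow (lintegral_mono fun x => ?_) (by positivity)
        rw [← mul_assoc]
        gcongr
        exact hin x
    _ = _ := by
        rw [lintegral_const_mul' _ _ hCm, ENNReal.mul_rpow_of_nonneg _ _ (by positivity),
          ← ENNReal.rpow_mul, mul_one_div_cancel hm.ne', ENNReal.rpow_one]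

theorem theorem1p1 {n : ℕ} (hn : 0 < n)
    (p₁ p₂ m₁ m₂ α r : ℝ) (hp₁ : 0 < p₁) (hp₂ : 0 < p₂) (hm₁ : 0 < m₁) (hm₂ : 0 < m₂)
    (hα : 0 < α) (hαr : α ≤ r)
    (v w : ℝ → ℝ) (hv : IsWeight v) (hw : IsWeight w)
    (φ : ℝ → ℝ) (hφ_pos : ∀ t, 0 < t → 0 < φ t)
    (hφ_Q : QCondition r φ) (hφ_qi : QuasiIncreasing φ)
    (b : ℝ → ℝ) (hb : IsWeight b)
    (hB : ∀ t, 0 < t → 0 < weightPrimitive b t ∧ weightPrimitive b t < ∞)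
    (hB_delta : DeltaTwo (fun t => (weightPrimitive b t).toReal))
    (hB_top : ∫⁻ s in Ioi (0 : ℝ), ENNReal.ofReal (b s) = ∞)
    (hB_qi : QuasiIncreasing (fun t => (weightPrimitive b t).toReal / t ^ (α / r))) :
    (∃ C : ℝ≥0, 0 < C ∧ ∀ f : (Fin n → ℝ) → EReal, AEMeasurable f volume →
      gGammaNorm p₂ m₂ w (genMaximal φ α b f) ≤ C * gGammaNorm p₁ m₁ v (modulus f)) ↔
    (∃ C : ℝ≥0, 0 < C ∧ ∀ h : (Fin n → ℝ) → EReal, AEMeasurable h volume →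
      (∫⁻ x in Ioi (0 : ℝ),
          (∫⁻ t in Ioo 0 x,
            supHardy (fun τ => weightPrimitive b τ / ENNReal.ofReal (φ τ) ^ α) b
              (rearr (modulus h)) t ^ (p₂ / α)) ^ (m₂ / p₂) * ENNReal.ofReal (w x)) ^ (1 / m₂)
        ≤ C * (∫⁻ x in Ioi (0 : ℝ),
          (∫⁻ τ in Ioo 0 x, rearr (modulus h) τ ^ (p₁ / α)) ^ (m₁ / p₁) *
            ENNReal.ofReal (v x)) ^ (1 / m₁)) := by

  have hr : 0 < r := hα.trans_le hαr
  constructor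
  · rintro ⟨C, -, hC⟩
    obtain ⟨D, hD, hle⟩ := exists_supHardy_le_rearr_genMaximal hn hα hr hφ_pos hφ_Q hB
    -- The summand 1 only secures positivity, since D may be 0.
    refine ⟨D.toNNReal * C + 1, by positivity, fun h _ => ?_⟩
    have h1 := iterated_lintegral_le_const_mul hp₂ hm₂ w hD (hle (modulus h))
    have h2 := hC _ (measurable_radial α (modulus h)).aemeasurable
    have h3 := iterated_lintegral_le_const_mul hp₁ hm₁ v ENNReal.one_ne_top
      (F := rearr (modulus (radial α (modulus h)))) (G := fun t => rearr (modulus h) t ^ (1 / α))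
      (fun t ht => by rw [one_mul]; exact rearr_modulus_radial_le hn hα _ ht)
    simp_rw [← ENNReal.rpow_mul, one_div_mul_eq_div] at h1 h3
    rw [one_mul] at h3
    refine h1.trans ((mul_le_mul' le_rfl (h2.trans (mul_le_mul' le_rfl h3))).trans ?_)
    rw [← mul_assoc]
    gcongr
    push_cast
    rw [ENNReal.coe_toNNReal hD]
    exact le_self_add
  · rintro ⟨C, -, hC⟩
    obtain ⟨D, hD, hle⟩ := exists_rearr_genMaximal_le (n := n) hα hαr hφ_pos hφ_Q hb hB hB_qi
    refine ⟨D.toNNReal * C + 1, by positivity, fun f hf => ?_⟩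
    have h1 := iterated_lintegral_le_const_mul hp₂ hm₂ w hD (hle f)
    -- Test function |f|^α, whose rearrangement is (f^*)^α.
    have h2 := hC (fun x => ((modulus f x ^ α : ℝ≥0∞) : EReal))
      (measurable_coe_ennreal_ereal.comp_aemeasurable
        ((measurable_ereal_abs.comp_aemeasurable hf).pow_const α))
    have hmod : modulus (fun x => ((modulus f x ^ α : ℝ≥0∞) : EReal)) =
        fun x => modulus f x ^ α := funext fun x => ereal_abs_coe_ennreal _
    have hrearr : rearr (fun x => modulus f x ^ α) = fun t => rearr (modulus f) t ^ α :=
      funext fun t => rearr_rpow _ hα t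
    rw [hmod, hrearr] at h2
    simp_rw [← ENNReal.rpow_mul, one_div_mul_eq_div] at h1
    simp_rw [← ENNReal.rpow_mul, mul_div_cancel₀ _ hα.ne'] at h2
    refine h1.trans ((mul_le_mul' le_rfl h2).trans ?_)
    rw [← mul_assoc, gGammaNorm]
    gcongr
    push_cast
    rw [ENNReal.coe_toNNReal hD]
    exact le_self_add
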